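/- **Definitions.** An oriented graph $H$ has vertex set $V(H)$, arc set $E(H)$ (no loops, at most one of $uv$, $vu$), and $\|H\|=|E(H)|$. A kernel is a bounded measurable function $U:[0,1]^2\to\mathbb R$; it is antisymmetric if $U(x,y)=-U(y,x)$ for all $x,y$. The homomorphism density of $H$ in $U$ is $$t(H,U)=\int_{[0,1]^{V(H)}}\prod_{vw\in E(H)}U(x_v,x_w)\,dx .$$ A tournamenton is a non-negative kernel $W$ with $W(x,y)+W(y,x)=1$ for all $x,y\in[0,1]$. An oriented graph $H$ is quasirandom-forcing if every tournamenton $W$ with $t(H,W)=2^{-\|H\|}$ equals $1/2$ almost everywhere. $Q_{2}$ is the two-edge path with both edges oriented away from its central vertex, and $D_{2k}$ is the orientation of the cycle of length $2k$ in which all edges are oriented from one of two opposite vertices towards the other. For an orientation $C$ of a cycle, $\alpha_C(2)$ is the number of sets $F\subseteq E(C)$ such that the spanning subgraph of $C$ with edge set $F$ can be obtained from $Q_2$ by reversing an even number of edges and possibly adding isolated vertices, minus the number of those $F$ for which it can be so obtained by reversing an odd number of edges. If $C$ has length $2k$, then $\gamma_C=+1$ if $C$ can be obtained from $D_{2k}$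 by reversing an even number of edges, and $\gamma_C=-1$ otherwise. **Theorem.** Let $C$ be the orientation of the cycle $v_0v_1\cdots v_9$ of length $10$ with the arcs $$v_1v_0,\ v_2v_1,\ v_3v_2,\ v_3v_4,\ v_5v_4,\ v_5v_6,\ v_7v_6,\ v_7v_8,\ v_8v_9,\ v_9v_0$$ (where $uv$ denotes the arc directed from $u$ to $v$). Then $\gamma_C=+1$ and $\alpha_C(2)=2$. For every antisymmetric kernel $U:[0,1]^2\to[-1/2,1/2]$, $$t\left(C,\tfrac12+U\right)\ \ge\ 2^{-10}+t(D_{10},U).$$ Moreover, $C$ is quasirandom-forcing, and so is the orientation obtained from $C$ by reversing all its edges. -/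

import Mathlib

open MeasureTheory
open scoped unitInterval

/-- An oriented graph: there are no loops, and at most one of the two arcs `(u, v)`, `(v, u)`
is present. The arc `(u, v)` is directed from `u` to `v`. -/
structure OrientedGraph (V : Type) where
  edges : Finset (V × V)
  asymm : ∀ u v, (u, v) ∈ edges → (v, u) ∉ edges

namespace OrientedGraph

/-- `H⟨F⟩`, the spanning subgraph of `H` with edge set `F` (for `F ⊆ E(H)`). -/
def spanning {V : Type} [DecidableEq V] (H : OrientedGraph V) (F : Finset (V × V)) :
    OrientedGraph V where
  edges := H.edges ∩ F
  asymm u v h h' :=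
    H.asymm u v (Finset.mem_inter.1 h).1 (Finset.mem_inter.1 h').1

/-- The oriented graph obtained from `H` by reversing exactly those of its edges that are in `R`. -/
def reorient {V : Type} [DecidableEq V] (H : OrientedGraph V) (R : Finset (V × V)) :
    OrientedGraph V where
  edges := (H.edges \ R) ∪ (H.edges ∩ R).image Prod.swap
  asymm u v h h' := by
    have := H.asymm
    simp only [Finset.mem_union, Finset.mem_sdiff, Finset.mem_image, Finset.mem_inter,
      Prod.exists, Prod.swap_prod_mk, Prod.mk.injEq] at h h'
    grind

/-- The oriented graph obtained from `H` by reversing all edges. -/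
def reverse {V : Type} [DecidableEq V] (H : OrientedGraph V) : OrientedGraph V :=
  H.reorient H.edges

/-- `G` is, up to the names of the vertices, `H` together with some (possibly zero) additional
isolated vertices. -/
def IsCopyWithIsolated {V V' : Type} [DecidableEq V'] (H : OrientedGraph V)
    (G : OrientedGraph V') : Prop :=
  ∃ φ : V ↪ V', G.edges = H.edges.image (Prod.map φ φ)

/-- `G` can be obtained from `H` by reversing an even number of edges and possibly adding
isolated vertices. -/
def EvenReorientation {V V' : Type} [DecidableEq V] [DecidableEq V'] (H : OrientedGraph V)
    (G : OrientedGraph V') : Prop :=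
  ∃ R : Finset (V × V), R ⊆ H.edges ∧ Even R.card ∧ (H.reorient R).IsCopyWithIsolated G

/-- `G` can be obtained from `H` by reversing an odd number of edges and possibly adding
isolated vertices. -/
def OddReorientation {V V' : Type} [DecidableEq V] [DecidableEq V'] (H : OrientedGraph V)
    (G : OrientedGraph V') : Prop :=
  ∃ R : Finset (V × V), R ⊆ H.edges ∧ Odd R.card ∧ (H.reorient R).IsCopyWithIsolated G

/-- The disjoint union of a finite family of oriented graphs. -/
def disjointUnion {ι : Type} [Fintype ι] [DecidableEq ι] {V : ι → Type} [∀ i, DecidableEq (V i)]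
    (H : ∀ i, OrientedGraph (V i)) : OrientedGraph (Σ i, V i) where
  edges := Finset.univ.biUnion fun i =>
    (H i).edges.image fun e => ((⟨i, e.1⟩ : Σ i, V i), (⟨i, e.2⟩ : Σ i, V i))
  asymm := by
    rintro ⟨i, u⟩ ⟨j, v⟩ h h'
    simp only [Finset.mem_biUnion, Finset.mem_univ, true_and, Finset.mem_image, Prod.exists,
      Prod.mk.injEq] at h h'
    obtain ⟨i', a, b, hab, h1, h2⟩ := h
    obtain ⟨j', c, d, hcd, h3, h4⟩ := h'
    cases h1
    cases h2
    cases h3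
    cases h4
    exact (H _).asymm _ _ hab hcd

/-- `Q_{2k}`: the path with vertices `0, 1, …, 2k` (in this order), with all edges directed from
the central vertex `k` towards the two end vertices. -/
def pathQ (k : ℕ) : OrientedGraph (Fin (2 * k + 1)) where
  edges := Finset.univ.filter fun e =>
    (k ≤ e.1.val ∧ e.2.val = e.1.val + 1) ∨ (e.1.val ≤ k ∧ e.1.val = e.2.val + 1)
  asymm u v h h' := by
    simp only [Finset.mem_filter, Finset.mem_univ, true_and] at h h'
    omega

/-- The successor of a vertex on the cycle `0, 1, …, n - 1`. -/
def cycleSucc {n : ℕ} (hn : 3 ≤ n) (i : Fin n) : Fin n :=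
  ⟨(i.val + 1) % n, Nat.mod_lt _ (by omega)⟩

/-- The orientation of the cycle `0, 1, …, n - 1` in which the edge joining `i` and its successor
is directed from `i` to the successor if `s i = true`, and from the successor to `i` otherwise. -/
def cycle {n : ℕ} (hn : 3 ≤ n) (s : Fin n → Bool) : OrientedGraph (Fin n) where
  edges := Finset.univ.image fun i =>
    if s i then (i, cycleSucc hn i) else (cycleSucc hn i, i)
  asymm u v h h' := by
    have hs : ∀ i : Fin n, (i.val + 1 < n ∧ (cycleSucc hn i).val = i.val + 1) ∨
        (i.val + 1 = n ∧ (cycleSucc hn i).val = 0) := by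
      intro i
      rcases Nat.lt_or_ge (i.val + 1) n with h | h
      · exact Or.inl ⟨h, Nat.mod_eq_of_lt h⟩
      · have hi : i.val + 1 = n := by omega
        exact Or.inr ⟨hi, by simp [cycleSucc, hi]⟩
    simp only [Finset.mem_image, Finset.mem_univ, true_and] at h h'
    obtain ⟨i, hi⟩ := h
    obtain ⟨j, hj⟩ := h'
    have h1 := hs i
    have h2 := hs j
    by_cases e : i = j
    · subst e
      split_ifs at hi hj <;> simp only [Prod.mk.injEq, Fin.ext_iff] at hi hj <;> omega
    · rw [Fin.ext_iff] at e
      split_ifs at hi hj <;> simp only [Prod.mk.injEq, Fin.ext_iff] at hi hj <;> omega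

/-- `D_{2k}`: the cycle of length `2k` with all edges directed from the vertex `0` towards the
opposite vertex `k`. -/
def cycleD (k : ℕ) (hk : 2 ≤ k) : OrientedGraph (Fin (2 * k)) :=
  cycle (by omega) fun i => decide (i.val < k)

open Classical in
/-- `α_C(2n_1, …, 2n_k)` for the list `l = [n_1, …, n_k]` of positive integers. -/
noncomputable def alpha {V : Type} (C : OrientedGraph V) (l : List ℕ) : ℤ :=
  ((C.edges.powerset.filter fun F =>
      (disjointUnion fun i : Fin l.length => pathQ (l.get i)).EvenReorientation
        (C.spanning F)).card : ℤ) -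
  ((C.edges.powerset.filter fun F =>
      (disjointUnion fun i : Fin l.length => pathQ (l.get i)).OddReorientation
        (C.spanning F)).card : ℤ)

open Classical in
/-- `γ_C` for an orientation `C` of a cycle of length `2k`. -/
noncomputable def gamma (k : ℕ) (hk : 2 ≤ k) (C : OrientedGraph (Fin (2 * k))) : ℤ :=
  if (cycleD k hk).EvenReorientation C then 1 else -1

/-- The homomorphism density `t(H, U)` of an oriented graph `H` in a kernel `U`. -/
noncomputable def density {V : Type} [Fintype V] (H : OrientedGraph V) (U : I → I → ℝ) : ℝ :=
  ∫ x : V → I, ∏ e ∈ H.edges, U (x e.1) (x e.2)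

end OrientedGraph

/-- A kernel: a bounded measurable function on `[0,1]²`. -/
def IsKernel (U : I → I → ℝ) : Prop :=
  Measurable (fun p : I × I => U p.1 p.2) ∧ ∃ M : ℝ, ∀ x y, |U x y| ≤ M

/-- An antisymmetric kernel. -/
def IsAntisymmKernel (U : I → I → ℝ) : Prop :=
  IsKernel U ∧ ∀ x y, U x y = -U y x

/-- A tournamenton: a non-negative kernel `W` with `W(x,y) + W(y,x) = 1` everywhere. -/
def IsTournamenton (W : I → I → ℝ) : Prop :=
  IsKernel W ∧ (∀ x y, 0 ≤ W x y) ∧ ∀ x y, W x y + W y x = 1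

/-- `H` is quasirandom-forcing: every tournamenton `W` with `t(H, W) = 2^{-‖H‖}` is equal to `1/2`
almost everywhere on `[0,1]²`. -/
def OrientedGraph.QuasirandomForcing {V : Type} [Fintype V] (H : OrientedGraph V) : Prop :=
  ∀ W : I → I → ℝ, IsTournamenton W → H.density W = (1 / 2 : ℝ) ^ H.edges.card →
    ∀ᵐ p : I × I, W p.1 p.2 = 1 / 2

/-- The orientation of the cycle `0, 1, …, 9` with the arcs
`1 → 0`, `2 → 1`, `3 → 2`, `3 → 4`, `5 → 4`, `5 → 6`, `7 → 6`, `7 → 8`, `8 → 9`, `9 → 0`. -/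
def tenCycle : OrientedGraph (Fin 10) :=
  OrientedGraph.cycle (by norm_num)
    ![false, false, false, true, false, true, false, true, true, true]

/-! Write `W = 1/2 + U`. By antisymmetry an arc against the cyclic order contributes `1/2 - U`, so
the density of the ten-cycle is a cyclic integral of factors `1/2 + e_j U` with signs `e_j`. The
term with `U` taken in every factor is exactly the density of `D₁₀` in `U`, because both
orientations have an odd number of backward arcs.

Every other term contains a constant factor, which cuts the cycle into a path. What remains is a
computation in the span of `1, U1, U²1, …`, so these terms add up to a polynomial in the moments `∫
Uᵏ1` (`integral_cycle_one_half_add`, `sum_tenCycle_eq`). Odd moments vanish, and `∫ U²ᵏ1 = (-1)ᵏ pₖ`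
with `pₖ = ‖Uᵏ1‖²`.

The polynomial is at least `2⁻¹⁰` (`moment_polynomial_nonneg`) because of three facts: `p₁ ≤ 1/12`,
from the density of cyclic triangles; `pₖ₊₁ ≤ pₖ/8`, from the operator norm of `U`; and `‖(U² + 1/8)
Uᵏ1‖² ≥ 0`.

Finally, the density of `D₁₀` in `U` is `-tr U¹⁰ = ‖U⁵‖²` in the Hilbert–Schmidt norm. If the
density in `W` is `2⁻¹⁰`, then `U⁵ = 0`, and an antisymmetric nilpotent operator is zero
(`ae_eq_zero_of_trace_kernelPow`). -/

/-- A bounded measurable real function. -/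
def BddMeas {α : Type*} [MeasurableSpace α] (f : α → ℝ) : Prop :=
  Measurable f ∧ ∃ M : ℝ, ∀ x, |f x| ≤ M

namespace BddMeas

variable {α β : Type*} [MeasurableSpace α] [MeasurableSpace β]

lemma const (c : ℝ) : BddMeas (fun _ : α => c) := ⟨measurable_const, |c|, fun _ => le_rfl⟩

lemma add {f g : α → ℝ} (hf : BddMeas f) (hg : BddMeas g) : BddMeas (fun x => f x + g x) := by
  obtain ⟨hf, M, hM⟩ := hf
  obtain ⟨hg, N, hN⟩ := hg
  exact ⟨hf.add hg, M + N, fun x => (abs_add_le _ _).trans (add_le_add (hM x) (hN x))⟩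

lemma mul {f g : α → ℝ} (hf : BddMeas f) (hg : BddMeas g) : BddMeas (fun x => f x * g x) := by
  obtain ⟨hf, M, hM⟩ := hf
  obtain ⟨hg, N, hN⟩ := hg
  refine ⟨hf.mul hg, M * N, fun x => ?_⟩
  rw [abs_mul]
  exact mul_le_mul (hM x) (hN x) (abs_nonneg _) ((abs_nonneg _).trans (hM x))

lemma const_mul {f : α → ℝ} (c : ℝ) (hf : BddMeas f) : BddMeas (fun x => c * f x) :=
  (const c).mul hf

lemma prod {ι : Type*} (s : Finset ι) {f : ι → α → ℝ} (hf : ∀ i, BddMeas (f i)) :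
    BddMeas (fun x => ∏ i ∈ s, f i x) := by
  classical
  induction s using Finset.induction_on with
  | empty => simpa using const (α := α) 1
  | insert i s hi ih => simpa [Finset.prod_insert hi] using (hf i).mul ih

lemma comp {f : α → ℝ} (hf : BddMeas f) {φ : β → α} (hφ : Measurable φ) :
    BddMeas (fun x => f (φ x)) := by
  obtain ⟨hf, M, hM⟩ := hf
  exact ⟨hf.comp hφ, M, fun x => hM _⟩

lemma integrable {f : α → ℝ} (hf : BddMeas f) (μ : Measure α) [IsFiniteMeasure μ] :
    Integrable f μ := by
  obtain ⟨hf, M, hM⟩ := hf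
  exact Integrable.of_bound hf.aestronglyMeasurable M (.of_forall hM)

lemma integral_right {f : α → β → ℝ} (hf : BddMeas (fun p : α × β => f p.1 p.2))
    (μ : Measure β) [IsProbabilityMeasure μ] : BddMeas (fun x => ∫ y, f x y ∂μ) := by
  obtain ⟨hf, M, hM⟩ := hf
  refine ⟨(hf.stronglyMeasurable.integral_prod_right (ν := μ)).measurable, M, fun x => ?_⟩
  simpa using norm_integral_le_of_norm_le_const (μ := μ) (f := fun y => f x y) (C := M)
    (.of_forall fun y => hM (x, y))

end BddMeas

/-! ### Kernels as integral operators. -/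

/-- The integral operator with kernel `K`. -/
noncomputable def kernelOp (K : I → I → ℝ) (f : I → ℝ) (x : I) : ℝ := ∫ y, K x y * f y

/-- The composition of two kernels. -/
noncomputable def kernelComp (K L : I → I → ℝ) (x z : I) : ℝ := ∫ y, K x y * L y z

lemma IsKernel.iff_bddMeas {K : I → I → ℝ} :
    IsKernel K ↔ BddMeas (fun p : I × I => K p.1 p.2) := by
  simp [IsKernel, BddMeas]

lemma IsKernel.comp_meas {α : Type*} [MeasurableSpace α] {K : I → I → ℝ} (hK : IsKernel K)
    {φ ψ : α → I} (hφ : Measurable φ) (hψ : Measurable ψ) :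
    BddMeas (fun x => K (φ x) (ψ x)) :=
  (IsKernel.iff_bddMeas.1 hK).comp (hφ.prodMk hψ)

lemma IsKernel.transpose {K : I → I → ℝ} (hK : IsKernel K) : IsKernel (fun x y => K y x) :=
  IsKernel.iff_bddMeas.2 (hK.comp_meas measurable_snd measurable_fst)

lemma IsKernel.kernelOp {K : I → I → ℝ} (hK : IsKernel K) {f : I → ℝ} (hf : BddMeas f) :
    BddMeas (kernelOp K f) :=
  BddMeas.integral_right (f := fun x y => K x y * f y)
    ((hK.comp_meas measurable_fst measurable_snd).mul (hf.comp measurable_snd)) volume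

lemma IsKernel.kernelComp {K L : I → I → ℝ} (hK : IsKernel K) (hL : IsKernel L) :
    IsKernel (kernelComp K L) := by
  rw [IsKernel.iff_bddMeas]
  exact BddMeas.integral_right (f := fun (p : I × I) y => K p.1 y * L y p.2)
    ((hK.comp_meas (by fun_prop) (by fun_prop)).mul (hL.comp_meas (by fun_prop) (by fun_prop)))
    volume

lemma kernelComp_assoc {K L M : I → I → ℝ} (hK : IsKernel K) (hL : IsKernel L)
    (hM : IsKernel M) :
    kernelComp (kernelComp K L) M = kernelComp K (kernelComp L M) := by
  funext x z
  simp only [kernelComp, ← integral_mul_const, ← integral_const_mul]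
  rw [integral_integral_swap]
  · simp only [mul_assoc]
  · exact BddMeas.integrable (((hK.comp_meas (by fun_prop) (by fun_prop)).mul
      (hL.comp_meas (by fun_prop) (by fun_prop))).mul
      (hM.comp_meas (by fun_prop) (by fun_prop))) _

lemma kernelOp_kernelComp {K L : I → I → ℝ} (hK : IsKernel K) (hL : IsKernel L)
    {f : I → ℝ} (hf : BddMeas f) :
    kernelOp (kernelComp K L) f = kernelOp K (kernelOp L f) := by
  funext x
  simp only [kernelComp, kernelOp, ← integral_mul_const, ← integral_const_mul]
  rw [integral_integral_swap]
  · simp only [mul_assoc]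
  · exact BddMeas.integrable (((hK.comp_meas (by fun_prop) (by fun_prop)).mul
      (hL.comp_meas (by fun_prop) (by fun_prop))).mul
      (hf.comp (by fun_prop))) _

lemma integral_mul_kernelOp {K : I → I → ℝ} (hK : IsKernel K)
    {f g : I → ℝ} (hf : BddMeas f) (hg : BddMeas g) :
    ∫ x, f x * kernelOp K g x = ∫ x, kernelOp (fun x y => K y x) f x * g x := by
  simp only [kernelOp, ← integral_mul_const, ← integral_const_mul]
  rw [integral_integral_swap]
  · refine integral_congr_ae (.of_forall fun y => integral_congr_ae (.of_forall fun x => ?_))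
    ring
  · exact BddMeas.integrable ((hf.comp (by fun_prop)).mul
      ((hK.comp_meas (by fun_prop) (by fun_prop)).mul (hg.comp (by fun_prop)))) _

lemma IsAntisymmKernel.integral_mul_kernelOp {U : I → I → ℝ} (hU : IsAntisymmKernel U)
    {f g : I → ℝ} (hf : BddMeas f) (hg : BddMeas g) :
    ∫ x, f x * kernelOp U g x = -∫ x, kernelOp U f x * g x := by
  rw [_root_.integral_mul_kernelOp hU.1 hf hg, ← integral_neg]
  refine integral_congr_ae (.of_forall fun x => ?_)
  have : kernelOp (fun x y => U y x) f x = -kernelOp U f x := by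
    simp only [kernelOp, ← integral_neg, ← neg_mul]
    exact integral_congr_ae (.of_forall fun y => by simp only [hU.2 x y, neg_neg])
  simp [this]

/-! ### Cyclic integrals as traces. -/

/-- `K₀ ∘ K₁ ∘ ⋯ ∘ Kₙ₋₁ ∘ G`. -/
noncomputable def kernelCompIter :
    (n : ℕ) → (Fin n → I → I → ℝ) → (I → I → ℝ) → I → I → ℝ
  | 0, _, G => G
  | n + 1, K, G => kernelCompIter n (fun i => K i.castSucc) (kernelComp (K (Fin.last n)) G)

/-- Integrating out the last vertex merges the last path kernel with the closing kernel `G`;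
induction on the length with `G` arbitrary then contracts the cycle to a single vertex. -/
lemma integral_path_eq_trace (n : ℕ) (K : Fin n → I → I → ℝ) (hK : ∀ i, IsKernel (K i))
    (G : I → I → ℝ) (hG : IsKernel G) :
    ∫ x : Fin (n + 1) → I, (∏ i : Fin n, K i (x i.castSucc) (x i.succ)) *
      G (x (Fin.last n)) (x 0) = ∫ y, kernelCompIter n K G y y := by
  induction n generalizing G with
  | zero =>
    have h := (volume_preserving_funUnique (Fin 1) I).integral_comp
      (MeasurableEquiv.measurableEmbedding _) (fun y => G y y)
    simp only [Finset.univ_eq_empty, Finset.prod_empty, one_mul, kernelCompIter, ← h]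
    congr!
  | succ n ih =>
    rw [kernelCompIter, ← ih _ (fun i => hK _) _ ((hK _).kernelComp hG)]
    have h := ((volume_preserving_piFinSuccAbove (fun _ : Fin (n + 2) => I)
      (Fin.last (n + 1))).symm).integral_comp
      (MeasurableEquiv.measurableEmbedding _)
      (fun x : Fin (n + 2) → I => (∏ i : Fin (n + 1), K i (x i.castSucc) (x i.succ)) *
        G (x (Fin.last (n + 1))) (x 0))
    rw [← h, Measure.volume_eq_prod, integral_prod_symm]
    · refine integral_congr_ae (.of_forall fun x => ?_)
      simp only [kernelComp, ← integral_const_mul]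
      refine integral_congr_ae (.of_forall fun y => ?_)
      have e1 : ∀ i : Fin (n + 1), (MeasurableEquiv.piFinSuccAbove (fun _ : Fin (n + 2) => I)
          (Fin.last (n + 1))).symm (y, x) i.castSucc = x i := by
        intro i
        simp [MeasurableEquiv.piFinSuccAbove, Fin.insertNthEquiv]
      have e2 : (MeasurableEquiv.piFinSuccAbove (fun _ : Fin (n + 2) => I)
          (Fin.last (n + 1))).symm (y, x) (Fin.last (n + 1)) = y := by
        simp [MeasurableEquiv.piFinSuccAbove, Fin.insertNthEquiv]
      have e3 : (MeasurableEquiv.piFinSuccAbove (fun _ : Fin (n + 2) => I)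
          (Fin.last (n + 1))).symm (y, x) 0 = x 0 := e1 0
      simp only [Fin.prod_univ_castSucc, Fin.succ_last, ← Fin.castSucc_succ, e1, e2, e3]
      ring
    · refine BddMeas.integrable (BddMeas.comp (α := Fin (n + 2) → I)
        (f := fun x => (∏ i : Fin (n + 1), K i (x i.castSucc) (x i.succ)) *
        G (x (Fin.last (n + 1))) (x 0)) ?_ (MeasurableEquiv.measurable _)) _
      exact (BddMeas.prod _ fun i => (hK i).comp_meas (by fun_prop) (by fun_prop)).mul
        (hG.comp_meas (by fun_prop) (by fun_prop))

lemma integral_rotate {n : ℕ} (c : Fin (n + 1)) (F : (Fin (n + 1) → I) → ℝ) :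
    ∫ x : Fin (n + 1) → I, F x = ∫ x : Fin (n + 1) → I, F (fun j => x (j - c)) := by
  have h := (volume_measurePreserving_piCongrLeft (fun _ : Fin (n + 1) => I)
    (Equiv.addRight c)).integral_comp (MeasurableEquiv.measurableEmbedding _) F
  rw [← h]
  refine integral_congr_ae (.of_forall fun x => ?_)
  have : (MeasurableEquiv.piCongrLeft (fun _ : Fin (n + 1) => I) (Equiv.addRight c)) x =
      fun j => x (j - c) := by
    funext j
    obtain ⟨k, rfl⟩ := (Equiv.addRight c).surjective j
    rw [MeasurableEquiv.coe_piCongrLeft, Equiv.piCongrLeft_apply_apply]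
    simp
  simp only [this]

lemma integral_cycle_eq_trace (n : ℕ) (K : Fin (n + 1) → I → I → ℝ) (hK : ∀ i, IsKernel (K i)) :
    ∫ x : Fin (n + 1) → I, ∏ i, K i (x i) (x (i + 1)) =
      ∫ y, kernelCompIter n (fun i => K i.castSucc) (K (Fin.last n)) y y := by
  rw [← integral_path_eq_trace n _ (fun i => hK _) _ (hK _)]
  refine integral_congr_ae (.of_forall fun x => ?_)
  simp [Fin.prod_univ_castSucc]

lemma integral_cycle_rotate (n : ℕ) (K : Fin (n + 1) → I → I → ℝ) (c : Fin (n + 1)) :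
    ∫ x : Fin (n + 1) → I, ∏ i, K i (x i) (x (i + 1)) =
      ∫ x : Fin (n + 1) → I, ∏ i, K (i + c) (x i) (x (i + 1)) := by
  rw [integral_rotate c]
  refine integral_congr_ae (.of_forall fun x => ?_)
  dsimp only
  rw [← Equiv.prod_comp (Equiv.addRight c)]
  refine Finset.prod_congr rfl fun i _ => ?_
  simp only [Equiv.coe_addRight, add_sub_cancel_right]
  congr 2
  abel

/-! ### Iterates of `U` on the constant function and their moments. -/

/-- The functions `1, U 1, U² 1, …`. -/
noncomputable def iterVec (U : I → I → ℝ) (k : ℕ) : I → ℝ := (kernelOp U)^[k] fun _ => 1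

lemma iterVec_zero (U : I → I → ℝ) : iterVec U 0 = fun _ => 1 := rfl

lemma iterVec_succ (U : I → I → ℝ) (k : ℕ) : iterVec U (k + 1) = kernelOp U (iterVec U k) :=
  Function.iterate_succ_apply' _ _ _

lemma iterVec_bddMeas {U : I → I → ℝ} (hU : IsKernel U) (k : ℕ) : BddMeas (iterVec U k) := by
  induction k with
  | zero => exact BddMeas.const 1
  | succ k ih => rw [iterVec_succ]; exact hU.kernelOp ih

lemma IsAntisymmKernel.integral_iterVec_mul_succ {U : I → I → ℝ} (hU : IsAntisymmKernel U)
    (i j : ℕ) :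
    ∫ x, iterVec U i x * iterVec U (j + 1) x = -∫ x, iterVec U (i + 1) x * iterVec U j x := by
  rw [iterVec_succ, iterVec_succ,
    hU.integral_mul_kernelOp (iterVec_bddMeas hU.1 i) (iterVec_bddMeas hU.1 j)]

/-- The adjoint of `U` is `-U`, so each of the `j` copies of `U` moved across the inner product
costs a sign. -/
lemma IsAntisymmKernel.integral_iterVec_mul {U : I → I → ℝ} (hU : IsAntisymmKernel U)
    (i j : ℕ) :
    ∫ x, iterVec U i x * iterVec U j x = (-1) ^ j * ∫ x, iterVec U (i + j) x := by
  induction j generalizing i with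
  | zero => simp [iterVec_zero]
  | succ j ih =>
    rw [hU.integral_iterVec_mul_succ, ih, show i + 1 + j = i + (j + 1) by ring]
    ring

lemma IsAntisymmKernel.integral_iterVec_odd {U : I → I → ℝ} (hU : IsAntisymmKernel U)
    {k : ℕ} (hk : Odd k) : ∫ x, iterVec U k x = 0 := by
  have h := hU.integral_iterVec_mul 0 k
  simp only [iterVec_zero, one_mul, zero_add, hk.neg_one_pow] at h
  linarith

/-! ### Coefficient calculus for products of factors `a/2 + eU`. -/

/-- The function `∑ cᵢ Uᵏ⁺ⁱ 1`, where `c₀, c₁, …` are the entries of a list. -/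
noncomputable def listVec (U : I → I → ℝ) : List ℝ → ℕ → I → ℝ
  | [], _, _ => 0
  | a :: c, k, x => a * iterVec U k x + listVec U c (k + 1) x

/-- The sum `∑ cᵢ mᵢ`, where `c₀, c₁, …` are the entries of a list. -/
def listDot : (ℕ → ℝ) → List ℝ → ℝ
  | _, [] => 0
  | m, a :: c => a * m 0 + listDot (fun k => m (k + 1)) c

lemma listVec_bddMeas {U : I → I → ℝ} (hU : IsKernel U) (c : List ℝ) (k : ℕ) :
    BddMeas (listVec U c k) := by
  induction c generalizing k with
  | nil => exact BddMeas.const 0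
  | cons a c ih => exact ((iterVec_bddMeas hU k).const_mul a).add (ih (k + 1))

lemma integral_listVec {U : I → I → ℝ} (hU : IsKernel U) (c : List ℝ) (k : ℕ) :
    ∫ x, listVec U c k x = listDot (fun j => ∫ x, iterVec U (k + j) x) c := by
  induction c generalizing k with
  | nil => simp [listVec, listDot]
  | cons a c ih =>
    simp only [listVec, listDot]
    rw [integral_add (((iterVec_bddMeas hU k).const_mul a).integrable _)
      ((listVec_bddMeas hU c _).integrable _), integral_const_mul, ih]
    simp only [add_zero, add_assoc, add_comm 1]

lemma kernelOp_add {K : I → I → ℝ} (hK : IsKernel K) {f g : I → ℝ} (hf : BddMeas f)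
    (hg : BddMeas g) (x : I) :
    kernelOp K (fun y => f y + g y) x = kernelOp K f x + kernelOp K g x := by
  have hKx : BddMeas fun y => K x y := hK.comp_meas measurable_const measurable_id
  simp only [kernelOp, mul_add]
  exact integral_add ((hKx.mul hf).integrable _) ((hKx.mul hg).integrable _)

lemma kernelOp_const_mul (K : I → I → ℝ) (c : ℝ) (f : I → ℝ) (x : I) :
    kernelOp K (fun y => c * f y) x = c * kernelOp K f x := by
  simp only [kernelOp, ← integral_const_mul]
  exact integral_congr_ae (.of_forall fun y => by ring)

lemma kernelOp_listVec {U : I → I → ℝ} (hU : IsKernel U) (c : List ℝ) (k : ℕ) (x : I) :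
    kernelOp U (listVec U c k) x = listVec U c (k + 1) x := by
  induction c generalizing k with
  | nil =>
    change ∫ y, U x y * 0 = 0
    simp
  | cons a c ih =>
    change kernelOp U (fun y => a * iterVec U k y + listVec U c (k + 1) y) x = _
    rw [kernelOp_add hU ((iterVec_bddMeas hU k).const_mul a) (listVec_bddMeas hU c _),
      kernelOp_const_mul, ih, listVec, iterVec_succ]

lemma listVec_map_mul (U : I → I → ℝ) (e : ℝ) (c : List ℝ) (k : ℕ) (x : I) :
    listVec U (c.map (e * ·)) k x = e * listVec U c k x := by
  induction c generalizing k with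
  | nil => simp [listVec]
  | cons a c ih => simp only [List.map_cons, listVec, ih]; ring

/-- The kernel `a / 2 + e U`. -/
noncomputable def affineKernel (U : I → I → ℝ) (a e : ℝ) (x y : I) : ℝ := a / 2 + e * U x y

lemma IsKernel.affineKernel {U : I → I → ℝ} (hU : IsKernel U) (a e : ℝ) :
    IsKernel (affineKernel U a e) :=
  IsKernel.iff_bddMeas.2 ((BddMeas.const _).add ((IsKernel.iff_bddMeas.1 hU).const_mul e))

/-- The coefficients of the image of a combination of `1, U 1, U² 1, …` under `a / 2 + e U`,
where `m` lists the integrals of these functions. -/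
noncomputable def affineStep (m : ℕ → ℝ) (a e : ℝ) (c : List ℝ) : List ℝ :=
  (a / 2 * listDot m c) :: c.map (e * ·)

/-- The constant kernel `a/2` sends `f` to the constant `(a/2) ∫ f`, while `U` shifts the
coefficients by one place. Hence the span of the iterates is preserved and only the moments enter.
-/
lemma kernelOp_affineKernel {U : I → I → ℝ} (hU : IsKernel U) (a e : ℝ) (c : List ℝ) :
    kernelOp (affineKernel U a e) (listVec U c 0) =
      listVec U (affineStep (fun j => ∫ x, iterVec U j x) a e c) 0 := by
  funext x
  have hUx : BddMeas fun y => U x y := hU.comp_meas measurable_const measurable_id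
  have hc := listVec_bddMeas hU c 0
  rw [affineStep, listVec, listVec_map_mul, ← kernelOp_listVec hU]
  simp only [kernelOp, affineKernel, add_mul, mul_assoc]
  rw [integral_add ((hc.const_mul _).integrable _) (((hUx.mul hc).const_mul e).integrable _),
    integral_const_mul, integral_const_mul, integral_listVec hU]
  simp [iterVec_zero]

/-- The iterated application of `affineStep`, the last index first. -/
noncomputable def affineSteps (m : ℕ → ℝ) :
    (n : ℕ) → (Fin n → ℝ) → (Fin n → ℝ) → List ℝ → List ℝ
  | 0, _, _, c => c
  | n + 1, a, e, c => affineSteps m n (fun i => a i.castSucc) (fun i => e i.castSucc)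
      (affineStep m (a (Fin.last n)) (e (Fin.last n)) c)

lemma kernelCompIter_affineKernel {U : I → I → ℝ} (hU : IsKernel U) (n : ℕ) (a e : Fin n → ℝ)
    (c : List ℝ) :
    kernelCompIter n (fun i => affineKernel U (a i) (e i)) (fun y _ => listVec U c 0 y) =
      fun y _ => listVec U (affineSteps (fun j => ∫ x, iterVec U j x) n a e c) 0 y := by
  induction n generalizing c with
  | zero => rfl
  | succ n ih =>
    rw [kernelCompIter, affineSteps, ← ih]
    congr 1
    funext y z
    rw [← kernelOp_affineKernel hU]
    rfl

/-- A cyclic product one of whose factors is the constant `1 / 2`. -/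
lemma integral_cycle_affineKernel {U : I → I → ℝ} (hU : IsKernel U) (n : ℕ)
    (a e : Fin (n + 1) → ℝ) (i : Fin (n + 1)) (ha : a i = 1) (he : e i = 0) :
    ∫ x : Fin (n + 1) → I, ∏ j, affineKernel U (a j) (e j) (x j) (x (j + 1)) =
      listDot (fun j => ∫ x, iterVec U j x) (affineSteps (fun j => ∫ x, iterVec U j x) n
        (fun k => a (k.castSucc + (i + 1))) (fun k => e (k.castSucc + (i + 1))) [1 / 2]) := by
  -- Rotation by `i + 1` makes the constant factor the closing kernel. It does not depend on its
  -- second variable, so all compositions act on functions of one variable and the trace becomes a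
  -- plain integral.
  rw [integral_cycle_rotate n (fun j => affineKernel U (a j) (e j)) (i + 1),
    integral_cycle_eq_trace n (fun j => affineKernel U (a (j + (i + 1))) (e (j + (i + 1))))
      (fun j => hU.affineKernel _ _)]
  have hlast : Fin.last n + (i + 1) = i := by
    rw [add_comm i, ← add_assoc, Fin.last_add_one, zero_add]
  have hG : affineKernel U (a (Fin.last n + (i + 1))) (e (Fin.last n + (i + 1))) =
      fun y _ => listVec U [1 / 2] 0 y := by
    funext y z
    simp [hlast, ha, he, affineKernel, listVec, iterVec_zero]
  rw [hG, kernelCompIter_affineKernel hU, integral_listVec hU]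
  simp only [zero_add]

/-- Expanding a product of factors `1 / 2 + e U` by the last factor from which `1 / 2` is taken. -/
lemma prod_affineKernel_eq {n : ℕ} (u e : Fin n → ℝ) :
    ∏ j, (1 / 2 + e j * u j) = ∏ j, e j * u j +
      ∑ i, ∏ j, ((if j ≤ i then 1 else 0) / 2 + (if j = i then 0 else e j) * u j) := by
  -- Factors before `i` stay intact, factor `i` is `1/2`, and later factors are `e_j u_j`. The two
  -- indicators write all three types in the common form `a/2 + e u`.
  have h := Finset.prod_add_ordered Finset.univ (fun j => e j * u j) (fun _ => (1 / 2 : ℝ))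
  simp only [add_comm _ (1 / 2 : ℝ)] at h
  rw [h]
  congr 1
  refine Finset.sum_congr rfl fun i _ => ?_
  rw [← Finset.mul_prod_erase Finset.univ _ (Finset.mem_univ i), mul_assoc]
  congr 1
  · simp
  · rw [Finset.prod_filter, Finset.prod_filter, ← Finset.prod_mul_distrib,
      ← Finset.mul_prod_erase Finset.univ _ (Finset.mem_univ i)]
    simp only [lt_irrefl, if_false, one_mul]
    refine Finset.prod_congr rfl fun j hj => ?_
    have hji := Finset.ne_of_mem_erase hj
    rcases lt_or_gt_of_ne hji with h | h
    · simp [h, h.le, hji, h.not_gt]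
    · simp [h, h.not_ge, hji, h.not_gt]

lemma integral_cycle_one_half_add {U : I → I → ℝ} (hU : IsKernel U) (n : ℕ)
    (e : Fin (n + 1) → ℝ) :
    ∫ x : Fin (n + 1) → I, ∏ j, (1 / 2 + e j * U (x j) (x (j + 1))) =
      (∫ x : Fin (n + 1) → I, ∏ j, e j * U (x j) (x (j + 1))) +
      ∑ i : Fin (n + 1), listDot (fun j => ∫ x, iterVec U j x)
        (affineSteps (fun j => ∫ x, iterVec U j x) n
          (fun k => if k.castSucc + (i + 1) ≤ i then 1 else 0)
          (fun k => if k.castSucc + (i + 1) = i then 0 else e (k.castSucc + (i + 1))) [1 / 2]) := by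
  have hb : ∀ j : Fin (n + 1), BddMeas fun x : Fin (n + 1) → I => U (x j) (x (j + 1)) :=
    fun j => hU.comp_meas (by fun_prop) (by fun_prop)
  have hi : ∀ i : Fin (n + 1), BddMeas fun x : Fin (n + 1) → I => ∏ j : Fin (n + 1),
      ((if j ≤ i then 1 else 0) / 2 + (if j = i then 0 else e j) * U (x j) (x (j + 1))) :=
    fun i => BddMeas.prod _ fun j => (BddMeas.const _).add ((hb j).const_mul _)
  simp only [prod_affineKernel_eq]
  rw [integral_add ((BddMeas.prod _ fun j => (hb j).const_mul _).integrable _)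
    (integrable_finsetSum _ fun i _ => (hi i).integrable _),
    integral_finsetSum _ fun i _ => (hi i).integrable _]
  congr 1
  refine Finset.sum_congr rfl fun i _ => ?_
  exact integral_cycle_affineKernel hU n (fun j => if j ≤ i then 1 else 0)
    (fun j => if j = i then 0 else e j) i (by simp) (by simp)
-- A finite computation, and the place where the particular sign pattern determines the polynomial.
-- Its linear term `8 p₁` is `4 α_C(2) p₁`.
lemma sum_tenCycle_eq (m : ℕ → ℝ) (p₁ p₂ p₃ p₄ : ℝ) (h0 : m 0 = 1) (h1 : m 1 = 0)
    (h2 : m 2 = -p₁) (h3 : m 3 = 0) (h4 : m 4 = p₂) (h5 : m 5 = 0) (h6 : m 6 = -p₃)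
    (h7 : m 7 = 0) (h8 : m 8 = p₄) (h9 : m 9 = 0) :
    ∑ i : Fin 10, listDot m (affineSteps m 9
          (fun k => if k.castSucc + (i + 1) ≤ i then 1 else 0)
          (fun k => if k.castSucc + (i + 1) = i then 0 else
            (![-1, -1, -1, 1, -1, 1, -1, 1, 1, 1] : Fin 10 → ℝ) (k.castSucc + (i + 1))) [1 / 2]) =
      (1 / 2) ^ 10 * (1 + 8 * p₁ - 48 * p₁ ^ 2 - 32 * p₂ + 384 * p₁ ^ 3 - 384 * p₁ * p₂
        - 128 * p₃ + 1536 * p₁ * p₃ + 256 * p₂ ^ 2 + 512 * p₄) := by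
  simp [Fin.sum_univ_succ, affineSteps, affineStep, listDot, h0, h1, h2, h3, h4, h5, h6, h7, h8, h9, Fin.ext_iff, Fin.le_def, Fin.val_add]
  ring

/-! ### Inequalities between the norms of the iterates. -/

lemma integral_nonneg_of_forall {α : Type*} [MeasurableSpace α] (μ : Measure α) {f : α → ℝ}
    (h : ∀ x, 0 ≤ f x) : 0 ≤ ∫ x, f x ∂μ :=
  integral_nonneg h

/-- The squared norm of `Uᵏ 1`. -/
noncomputable def iterNormSq (U : I → I → ℝ) (k : ℕ) : ℝ := ∫ x, iterVec U k x ^ 2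

lemma iterNormSq_nonneg (U : I → I → ℝ) (k : ℕ) : 0 ≤ iterNormSq U k :=
  integral_nonneg fun _ => sq_nonneg _

namespace IsAntisymmKernel

variable {U : I → I → ℝ}

lemma integral_iterVec_even (hU : IsAntisymmKernel U) (k : ℕ) :
    ∫ x, iterVec U (2 * k) x = (-1) ^ k * iterNormSq U k := by
  have h := hU.integral_iterVec_mul k k
  rw [two_mul, iterNormSq]
  simp only [sq]
  rw [h, ← mul_assoc, ← mul_pow]
  norm_num

/-- The spectrum of `-U²` on the cyclic space of `1` is non-negative. -/
lemma iterNormSq_convex (hU : IsAntisymmKernel U) (k : ℕ) (c : ℝ) :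
    0 ≤ iterNormSq U (k + 2) - 2 * c * iterNormSq U (k + 1) + c ^ 2 * iterNormSq U k := by
  have hb := fun k => iterVec_bddMeas hU.1 k
  have h1 : ∫ x, iterVec U k x * iterVec U (k + 2) x = -iterNormSq U (k + 1) := by
    rw [hU.integral_iterVec_mul_succ, iterNormSq]
    simp only [sq]
  -- The quantity is `‖(U² + c) Uᵏ1‖²`; by antisymmetry the cross term is `-2c‖Uᵏ⁺¹1‖²`.
  have h : ∫ x, (iterVec U (k + 2) x + c * iterVec U k x) ^ 2 =
      iterNormSq U (k + 2) - 2 * c * iterNormSq U (k + 1) + c ^ 2 * iterNormSq U k := by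
    have e : ∀ x, (iterVec U (k + 2) x + c * iterVec U k x) ^ 2 =
        iterVec U (k + 2) x ^ 2 + (2 * c * (iterVec U k x * iterVec U (k + 2) x)
          + c ^ 2 * iterVec U k x ^ 2) := fun x => by ring
    have hs : ∀ k, BddMeas fun x => iterVec U k x ^ 2 := fun k => by
      simpa only [sq] using (hb k).mul (hb k)
    have hm := ((hb k).mul (hb (k + 2))).const_mul (2 * c)
    have hc := (hs k).const_mul (c ^ 2)
    simp only [e]
    rw [integral_add ((hs _).integrable _) ((hm.add hc).integrable _),
      integral_add (hm.integrable _) (hc.integrable _), integral_const_mul, integral_const_mul, h1]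
    simp only [iterNormSq]
    ring
  rw [← h]
  exact integral_nonneg fun _ => sq_nonneg _

/-- The operator norm of an antisymmetric kernel bounded by `1 / 2` is at most `1 / √8`. -/
lemma integral_kernelOp_sq_le (hU : IsAntisymmKernel U) (hb : ∀ x y, |U x y| ≤ 1 / 2)
    {f : I → ℝ} (hf : BddMeas f) :
    ∫ x, kernelOp U f x ^ 2 ≤ (1 / 8) * ∫ x, f x ^ 2 := by
  set g := kernelOp U f with hg_def
  have hg : BddMeas g := hU.1.kernelOp hf
  have hK : BddMeas fun p : I × I => U p.1 p.2 := IsKernel.iff_bddMeas.1 hU.1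
  have hf1 : BddMeas fun p : I × I => f p.1 := hf.comp measurable_fst
  have hf2 : BddMeas fun p : I × I => f p.2 := hf.comp measurable_snd
  have hg1 : BddMeas fun p : I × I => g p.1 := hg.comp measurable_fst
  have hg2 : BddMeas fun p : I × I => g p.2 := hg.comp measurable_snd
  have hs : ∀ {h : I → ℝ}, BddMeas h → BddMeas fun x => h x ^ 2 := fun hh => by
    simpa only [sq] using hh.mul hh
  have hfg : ∫ x, f x * g x = 0 := by
    have h := hU.integral_mul_kernelOp hf hf
    simp only [← hg_def, mul_comm (g _)] at h
    linarith
  have h1 : ∫ p : I × I, g p.1 * (U p.1 p.2 * f p.2) = ∫ x, g x ^ 2 := by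
    rw [Measure.volume_eq_prod, integral_prod _ ((hg1.mul (hK.mul hf2)).integrable _)]
    refine integral_congr_ae (.of_forall fun x => ?_)
    simp only [integral_const_mul]
    rw [sq]
    rfl
  have h2 : ∫ p : I × I, g p.1 ^ 2 * f p.2 ^ 2 = (∫ x, g x ^ 2) * ∫ x, f x ^ 2 :=
    integral_prod_mul (fun x => g x ^ 2) (fun x => f x ^ 2)
  have h3 : ∫ p : I × I, (f p.1 * g p.1) * (f p.2 * g p.2) = 0 := by
    rw [Measure.volume_eq_prod, integral_prod_mul (fun x => f x * g x) (fun x => f x * g x), hfg,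
      zero_mul]
  have hi2 : BddMeas fun p : I × I => g p.1 ^ 2 * f p.2 ^ 2 :=
    ((hs hg).comp measurable_fst).mul ((hs hf).comp measurable_snd)
  have hi3 : BddMeas fun p : I × I => (f p.1 * g p.1) * (f p.2 * g p.2) :=
    (hf1.mul hg1).mul (hf2.mul hg2)
  have hi1 := hg1.mul (hK.mul hf2)
  have hswap : ∀ {F : I × I → ℝ}, ∫ p : I × I, F p.swap = ∫ p : I × I, F p := by
    intro F
    rw [Measure.volume_eq_prod]
    exact integral_prod_swap F
  have h1' : ∫ p : I × I, g p.2 * (U p.1 p.2 * f p.1) = -∫ x, g x ^ 2 := by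
    rw [← h1, ← hswap, ← integral_neg]
    refine integral_congr_ae (.of_forall fun p => ?_)
    simp only [Prod.fst_swap, Prod.snd_swap, hU.2 p.2 p.1]
    ring
  have h2' : ∫ p : I × I, g p.2 ^ 2 * f p.1 ^ 2 = (∫ x, g x ^ 2) * ∫ x, f x ^ 2 := by
    rw [← h2, ← hswap]
    rfl
  have hi1' : BddMeas fun p : I × I => g p.2 * (U p.1 p.2 * f p.1) := hg2.mul (hK.mul hf1)
  have hi2' : BddMeas fun p : I × I => g p.2 ^ 2 * f p.1 ^ 2 :=
    ((hs hg).comp measurable_snd).mul ((hs hf).comp measurable_fst)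
  set A := ∫ x, g x ^ 2 with hA
  set B := ∫ x, f x ^ 2 with hB
  have hA0 : 0 ≤ A := integral_nonneg fun _ => sq_nonneg _
  have hB0 : 0 ≤ B := integral_nonneg fun _ => sq_nonneg _
  -- Since `f` and `g = Uf` are orthogonal, the antisymmetric kernel `g(x)f(y) - g(y)f(x)` has
  -- squared norm `2AB`, and its inner product with `U` is `2A`. Expand `∫ (U - t(g(x)f(y) -
  -- g(y)f(x)))² ≥ 0` using `U² ≤ 1/4`. The two antisymmetric halves gain the factor 2 over the
  -- Hilbert–Schmidt bound.
  have key : ∀ t : ℝ, 0 ≤ 1 / 4 - 2 * t * (2 * A) + t ^ 2 * (2 * (A * B)) := by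
    intro t
    have hpt : ∀ p : I × I, 0 ≤ 1 / 4 + ((-(2 * t)) * (g p.1 * (U p.1 p.2 * f p.2))
        + ((2 * t) * (g p.2 * (U p.1 p.2 * f p.1)) + (t ^ 2 * (g p.1 ^ 2 * f p.2 ^ 2)
        + (t ^ 2 * (g p.2 ^ 2 * f p.1 ^ 2)
        + (-(2 * t ^ 2)) * ((f p.1 * g p.1) * (f p.2 * g p.2)))))) := by
      intro p
      have := abs_le.1 (hb p.1 p.2)
      nlinarith [sq_nonneg (U p.1 p.2 - t * (g p.1 * f p.2 - g p.2 * f p.1))]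
    have i3 := hi3.const_mul (-(2 * t ^ 2))
    have i2' := (hi2'.const_mul (t ^ 2)).add i3
    have i2 := (hi2.const_mul (t ^ 2)).add i2'
    have i1' := (hi1'.const_mul (2 * t)).add i2
    have i1 := (hi1.const_mul (-(2 * t))).add i1'
    have h := integral_nonneg_of_forall (volume : Measure (I × I)) hpt
    rw [integral_add ((BddMeas.const _).integrable _) (i1.integrable _),
      integral_add ((hi1.const_mul _).integrable _) (i1'.integrable _),
      integral_add ((hi1'.const_mul _).integrable _) (i2.integrable _),
      integral_add ((hi2.const_mul _).integrable _) (i2'.integrable _),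
      integral_add ((hi2'.const_mul _).integrable _) (i3.integrable _)] at h
    simp only [integral_const_mul, h1, h1', h2, h2', h3] at h
    simp only [integral_const, probReal_univ, one_smul] at h
    linarith
  rcases hB0.eq_or_lt with hB0 | hB0
  -- For `B = 0` the bound in `key` is linear in `t`, so a large `t` excludes `A > 0`.
  · have h := key (1 / (8 * A) + 1)
    rw [← hB0] at h ⊢
    rcases hA0.eq_or_lt with hA0 | hA0
    · simp [← hA0]
    · field_simp at h
      nlinarith
  -- The choice `t = 1/B` gives `0 ≤ 1/4 - 2A/B`.
  · have h := key (1 / B)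
    field_simp at h
    rw [div_mul_eq_mul_div, le_div_iff₀ (by norm_num)]
    linarith

lemma iterNormSq_succ_le (hU : IsAntisymmKernel U) (hb : ∀ x y, |U x y| ≤ 1 / 2) (k : ℕ) :
    iterNormSq U (k + 1) ≤ (1 / 8) * iterNormSq U k := by
  simpa only [iterNormSq, iterVec_succ] using
    hU.integral_kernelOp_sq_le hb (iterVec_bddMeas hU.1 k)

/-- The density of cyclic triangles in a tournamenton is non-negative. -/
lemma iterNormSq_one_le (hU : IsAntisymmKernel U) (hb : ∀ x y, |U x y| ≤ 1 / 2) :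
    iterNormSq U 1 ≤ 1 / 12 := by
  have hw := iterVec_bddMeas hU.1 1
  have hv : ∀ x, iterVec U 1 x = ∫ y, U x y := fun x => by
    simp [iterVec_succ, iterVec_zero, kernelOp]
  have hU1 : ∀ x, BddMeas (U x) := fun x => hU.1.comp_meas measurable_const measurable_id
  have h2 : ∫ x, iterVec U 2 x = -iterNormSq U 1 := by
    simpa using hU.integral_iterVec_even 1
  have hC : IsKernel (kernelComp U U) := hU.1.kernelComp hU.1
  have hv2 : ∀ x, ∫ z, kernelComp U U x z = iterVec U 2 x := fun x => by
    have := congrFun (kernelOp_kernelComp hU.1 hU.1 (BddMeas.const (1 : ℝ))) x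
    simpa [iterVec_succ, iterVec_zero, kernelOp] using this
  -- The right side is `∏(1/2 + u) + ∏(1/2 - u)` over the three values of `U` on the triangle: the
  -- two cyclic orientations. Each of its three quadratic terms integrates to `-p₁`, so the total is
  -- `1/4 - 3p₁`.
  have hpt : ∀ x y z, 0 ≤ 1 / 4 + (U x y * U y z + (U z x * U y z + U z x * U x y)) := by
    intro x y z
    have h1 := abs_le.1 (hb x y)
    have h2 := abs_le.1 (hb y z)
    have h3 := abs_le.1 (hb z x)
    have e1 := mul_nonneg (mul_nonneg (neg_le_iff_add_nonneg.1 h1.1)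
      (neg_le_iff_add_nonneg.1 h2.1)) (neg_le_iff_add_nonneg.1 h3.1)
    have e2 := mul_nonneg (mul_nonneg (sub_nonneg.2 h1.2) (sub_nonneg.2 h2.2)) (sub_nonneg.2 h3.2)
    linarith
  have hy : ∀ x z, 0 ≤ 1 / 4 + (kernelComp U U x z +
      (U z x * (-iterVec U 1 z) + U z x * iterVec U 1 x)) := by
    intro x z
    have hx := hU1 x
    have hz : BddMeas fun y => U y z := hU.1.comp_meas measurable_id measurable_const
    have h := integral_nonneg_of_forall (volume : Measure I) fun y => hpt x y z
    rw [integral_add ((BddMeas.const _).integrable _)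
      (((hx.mul hz).add ((hz.const_mul _).add (hx.const_mul _))).integrable _),
      integral_add ((hx.mul hz).integrable _)
      (((hz.const_mul _).add (hx.const_mul _)).integrable _),
      integral_add ((hz.const_mul _).integrable _) ((hx.const_mul _).integrable _),
      integral_const_mul, integral_const_mul, ← hv] at h
    have e : ∫ y, U y z = -iterVec U 1 z := by
      rw [hv, ← integral_neg]
      exact integral_congr_ae (.of_forall fun y => hU.2 y z)
    rw [e] at h
    simpa [kernelComp] using h
  have hx : ∀ x, 0 ≤ 1 / 4 + (iterVec U 2 x + (iterVec U 2 x - iterVec U 1 x ^ 2)) := by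
    intro x
    have hz : BddMeas fun z => U z x := hU.1.comp_meas measurable_id measurable_const
    have hCx : BddMeas fun z => kernelComp U U x z :=
      hC.comp_meas measurable_const measurable_id
    have hwn : BddMeas fun z => -iterVec U 1 z := by simpa using hw.const_mul (-1)
    have h := integral_nonneg_of_forall (volume : Measure I) fun z => hy x z
    rw [integral_add ((BddMeas.const _).integrable _)
      ((hCx.add ((hz.mul hwn).add (hz.mul (BddMeas.const _)))).integrable _),
      integral_add (hCx.integrable _) (((hz.mul hwn).add (hz.mul (BddMeas.const _))).integrable _),
      integral_add ((hz.mul hwn).integrable _) ((hz.mul (BddMeas.const _)).integrable _),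
      integral_mul_const, hv2] at h
    have e1 : ∫ z, U z x = -iterVec U 1 x := by
      rw [hv, ← integral_neg]
      exact integral_congr_ae (.of_forall fun y => hU.2 y x)
    have e2 : ∫ z, U z x * -iterVec U 1 z = iterVec U 2 x := by
      rw [iterVec_succ U 1, kernelOp]
      exact integral_congr_ae (.of_forall fun z => by simp only [hU.2 z x]; ring)
    rw [e1, e2] at h
    simp only [integral_const, probReal_univ, one_smul] at h
    linarith
  have hw2 := iterVec_bddMeas hU.1 2
  have hwsq : BddMeas fun x => iterVec U 1 x ^ 2 := by simpa only [sq] using hw.mul hw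
  have h := integral_nonneg_of_forall (volume : Measure I) hx
  have hsub : Integrable (fun x => iterVec U 2 x - iterVec U 1 x ^ 2) :=
    (hw2.integrable _).sub (hwsq.integrable _)
  have hadd : Integrable (fun x => iterVec U 2 x + (iterVec U 2 x - iterVec U 1 x ^ 2)) :=
    (hw2.integrable _).add hsub
  rw [integral_add (integrable_const _) hadd,
    integral_add (hw2.integrable _) hsub, integral_sub (hw2.integrable _) (hwsq.integrable _),
    h2] at h
  simp only [integral_const, probReal_univ, one_smul] at h
  change 0 ≤ 1 / 4 + (-iterNormSq U 1 + (-iterNormSq U 1 - iterNormSq U 1)) at h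
  linarith

end IsAntisymmKernel

/-- The polynomial is an exact combination of `h24`, `ha`, `h13`, the square, `h2`, `hb` and `hc`,
with weights 512, 1536, 128, 256, 24, 128 and 384. All of these are tight when `p₁ = 1/12` and `pₖ₊₁
= pₖ/8`, which explains the shift `1/8` in `h13` and `h24`. -/
lemma moment_polynomial_nonneg {p₁ p₂ p₃ p₄ : ℝ} (h0 : 0 ≤ p₁) (h1 : p₁ ≤ 1 / 12)
    (h2 : p₂ ≤ 1 / 8 * p₁) (h3 : p₃ ≤ 1 / 8 * p₂)
    (h13 : 0 ≤ p₃ - 2 * (1 / 8) * p₂ + (1 / 8) ^ 2 * p₁)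
    (h24 : 0 ≤ p₄ - 2 * (1 / 8) * p₃ + (1 / 8) ^ 2 * p₂) :
    0 ≤ 8 * p₁ - 48 * p₁ ^ 2 - 32 * p₂ + 384 * p₁ ^ 3 - 384 * p₁ * p₂
        - 128 * p₃ + 1536 * p₁ * p₃ + 256 * p₂ ^ 2 + 512 * p₄ := by
  have ha : 0 ≤ (1 / 12 - p₁) * (1 / 8 * p₂ - p₃) :=
    mul_nonneg (sub_nonneg.2 h1) (sub_nonneg.2 h3)
  have hb : 0 ≤ p₁ * (1 / 8 * p₁ - p₂) := mul_nonneg h0 (sub_nonneg.2 h2)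
  have hc : 0 ≤ p₁ * ((1 / 12 - p₁) * (3 / 32 - p₁)) :=
    mul_nonneg h0 (mul_nonneg (by linarith) (by linarith))
  nlinarith [sq_nonneg (p₂ - 1 / 8 * p₁)]

/-! ### Powers of `U` and the vanishing of their trace. -/

/-- The composition of `n + 1` copies of `U`. -/
noncomputable def kernelPow (U : I → I → ℝ) (n : ℕ) : I → I → ℝ := (kernelComp U)^[n] U

lemma kernelPow_succ (U : I → I → ℝ) (n : ℕ) :
    kernelPow U (n + 1) = kernelComp U (kernelPow U n) :=
  Function.iterate_succ_apply' _ _ _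

lemma IsKernel.kernelPow {U : I → I → ℝ} (hU : IsKernel U) (n : ℕ) : IsKernel (kernelPow U n) := by
  induction n with
  | zero => exact hU
  | succ n ih => rw [kernelPow_succ]; exact hU.kernelComp ih

lemma kernelComp_kernelPow {U : I → I → ℝ} (hU : IsKernel U) (m n : ℕ) :
    kernelComp (kernelPow U m) (kernelPow U n) = kernelPow U (m + n + 1) := by
  induction m with
  | zero => rw [zero_add, kernelPow_succ]; rfl
  | succ m ih =>
    rw [kernelPow_succ, kernelComp_assoc hU (hU.kernelPow m) (hU.kernelPow n), ih,
      ← kernelPow_succ]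
    congr 1
    ring

lemma kernelCompIter_kernelPow (U : I → I → ℝ) (n m : ℕ) :
    kernelCompIter n (fun _ => U) (kernelPow U m) = kernelPow U (n + m) := by
  induction n generalizing m with
  | zero => rw [zero_add]; rfl
  | succ n ih =>
    rw [kernelCompIter, ← kernelPow_succ, ih]
    congr 1
    ring

lemma kernelOp_kernelPow {U : I → I → ℝ} (hU : IsKernel U) (n : ℕ) {f : I → ℝ}
    (hf : BddMeas f) : kernelOp (kernelPow U n) f = (kernelOp U)^[n + 1] f := by
  induction n with
  | zero => rfl
  | succ n ih =>
    rw [kernelPow_succ, kernelOp_kernelComp hU (hU.kernelPow n) hf, ih,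
      ← Function.iterate_succ_apply' (kernelOp U)]

lemma IsKernel.iterate_kernelOp {U : I → I → ℝ} (hU : IsKernel U) {f : I → ℝ} (hf : BddMeas f)
    (n : ℕ) : BddMeas ((_root_.kernelOp U)^[n] f) := by
  induction n with
  | zero => exact hf
  | succ n ih => rw [Function.iterate_succ_apply']; exact hU.kernelOp ih

/-- Testing on indicators shows that `U` integrates to zero over rectangles, and a π-λ argument
extends this to all measurable sets. -/
lemma IsKernel.ae_eq_zero_of_kernelOp {U : I → I → ℝ} (hU : IsKernel U)
    (h : ∀ g : I → ℝ, BddMeas g → _root_.kernelOp U g =ᵐ[volume] 0) :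
    ∀ᵐ p : I × I, U p.1 p.2 = 0 := by
  have hi : Integrable (fun p : I × I => U p.1 p.2) :=
    (IsKernel.iff_bddMeas.1 hU).integrable _
  have hS : ∀ S : Set (I × I), MeasurableSet S → ∫ p in S, U p.1 p.2 = 0 := by
    have hrect : ∀ A B : Set I, MeasurableSet A → MeasurableSet B →
        ∫ p in A ×ˢ B, U p.1 p.2 = 0 := by
      intro A B hA hB
      rw [Measure.volume_eq_prod, setIntegral_prod _ (by
        rw [← Measure.volume_eq_prod]; exact hi.integrableOn)]
      have hg : BddMeas (B.indicator fun _ => (1 : ℝ)) :=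
        ⟨measurable_const.indicator hB, 1, fun x => by
          by_cases hx : x ∈ B <;> simp [hx]⟩
      have h0 : (fun x => ∫ y in B, U x y) =ᵐ[volume] 0 := by
        filter_upwards [h _ hg] with x hx
        rw [← hx, _root_.kernelOp, ← integral_indicator hB]
        refine integral_congr_ae (.of_forall fun y => ?_)
        by_cases hy : y ∈ B <;> simp [hy]
      rw [integral_congr_ae (ae_restrict_of_ae h0)]
      simp
    have huniv : ∫ p : I × I, U p.1 p.2 = 0 := by
      simpa using hrect Set.univ Set.univ .univ .univ
    intro S hS
    induction S, hS using MeasurableSpace.induction_on_inter generateFrom_prod.symm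
      isPiSystem_prod with
    | empty => simp
    | basic S hS =>
      obtain ⟨A, hA, B, hB, rfl⟩ := hS
      exact hrect A B hA hB
    | compl S hS ih =>
      have := integral_add_compl hS hi
      rw [ih, huniv] at this
      linarith
    | iUnion f hd hm ih =>
      rw [integral_iUnion hm hd hi.integrableOn]
      simp [ih]
  exact hi.ae_eq_zero_of_forall_setIntegral_eq_zero fun S hS' _ => hS S hS'

namespace IsAntisymmKernel

variable {U : I → I → ℝ}

lemma kernelPow_swap (hU : IsAntisymmKernel U) (n : ℕ) (x y : I) :
    kernelPow U n y x = (-1) ^ (n + 1) * kernelPow U n x y := by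
  induction n generalizing x y with
  | zero => simpa [kernelPow] using hU.2 y x
  | succ n ih =>
    have h := kernelComp_kernelPow hU.1 n 0
    rw [add_zero] at h
    conv_rhs => rw [← h]
    rw [kernelPow_succ]
    simp only [kernelComp, ← integral_const_mul]
    refine integral_congr_ae (.of_forall fun z => ?_)
    have h0 : kernelPow U 0 z y = U z y := rfl
    simp only [ih x z, hU.2 y z, h0]
    ring

/-- `‖Uf‖² = -⟨f, U²f⟩`, so the kernels of `U²` and `U` agree. -/
lemma kernelOp_ae_eq_zero (hU : IsAntisymmKernel U) {f : I → ℝ} (hf : BddMeas f)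
    (h : kernelOp U (kernelOp U f) =ᵐ[volume] 0) : kernelOp U f =ᵐ[volume] 0 := by
  have hg := hU.1.kernelOp hf
  have h0 : ∫ x, kernelOp U f x * kernelOp U f x = 0 := by
    have e := hU.integral_mul_kernelOp hf hg
    rw [eq_comm, neg_eq_iff_eq_neg] at e
    rw [e, neg_eq_zero]
    refine integral_eq_zero_of_ae ?_
    filter_upwards [h] with x hx
    simp [hx]
  rw [integral_eq_zero_iff_of_nonneg (fun x => mul_self_nonneg _) ((hg.mul hg).integrable _)] at h0
  filter_upwards [h0] with x hx
  simpa using hx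

/-- The power is `Uⁿ⁺¹ ∘ Uⁿ⁺¹`, and `Uⁿ⁺¹` is symmetric up to the sign `(-1)ⁿ⁺¹`, so its trace is a
signed Hilbert–Schmidt norm. -/
lemma trace_kernelPow (hU : IsAntisymmKernel U) (n : ℕ) :
    ∫ x, kernelPow U (2 * n + 1) x x =
      (-1) ^ (n + 1) * ∫ p : I × I, kernelPow U n p.1 p.2 ^ 2 := by
  have hn := hU.1.kernelPow n
  have hb : BddMeas fun p : I × I => kernelPow U n p.1 p.2 ^ 2 := by
    simpa only [sq] using (IsKernel.iff_bddMeas.1 hn).mul (IsKernel.iff_bddMeas.1 hn)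
  rw [Measure.volume_eq_prod, integral_prod _ (hb.integrable _), two_mul,
    ← kernelComp_kernelPow hU.1]
  simp only [kernelComp, ← integral_const_mul]
  refine integral_congr_ae (.of_forall fun x => integral_congr_ae (.of_forall fun y => ?_))
  dsimp only
  rw [hU.kernelPow_swap n x y]
  ring

lemma ae_eq_zero_of_trace_kernelPow (hU : IsAntisymmKernel U) (n : ℕ)
    (h : ∫ x, kernelPow U (2 * n + 1) x x = 0) : ∀ᵐ p : I × I, U p.1 p.2 = 0 := by
  have hn := hU.1.kernelPow n
  have hb : BddMeas fun p : I × I => kernelPow U n p.1 p.2 ^ 2 := by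
    simpa only [sq] using (IsKernel.iff_bddMeas.1 hn).mul (IsKernel.iff_bddMeas.1 hn)
  rw [hU.trace_kernelPow, mul_eq_zero_iff_left (by simp),
    integral_eq_zero_iff_of_nonneg (fun p => sq_nonneg _) (hb.integrable _)] at h
  have hp : ∀ᵐ x : I, ∀ᵐ y : I, kernelPow U n x y = 0 := by
    refine Measure.ae_ae_of_ae_prod (p := fun p : I × I => kernelPow U n p.1 p.2 = 0) ?_
    rw [← Measure.volume_eq_prod]
    filter_upwards [h] with p hp
    simpa using hp
  refine hU.1.ae_eq_zero_of_kernelOp fun g hg => ?_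
  -- Nilpotency descends one power at a time, since `U` and `U²` have the same kernel.
  have key : ∀ k, (kernelOp U)^[k + 1] g =ᵐ[volume] 0 → kernelOp U g =ᵐ[volume] 0 := by
    intro k
    induction k with
    | zero => exact id
    | succ k ih =>
      intro hk
      refine ih ?_
      rw [Function.iterate_succ_apply', Function.iterate_succ_apply'] at hk
      rw [Function.iterate_succ_apply']
      exact hU.kernelOp_ae_eq_zero (hU.1.iterate_kernelOp hg k) hk
  refine key n ?_
  rw [← kernelOp_kernelPow hU.1 n hg]
  filter_upwards [hp] with x hx
  refine integral_eq_zero_of_ae ?_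
  filter_upwards [hx] with y hy
  simp [hy]

end IsAntisymmKernel

/-! ### Combinatorics of the ten-cycle and densities of cycles. -/

namespace OrientedGraph

lemma eq_of_subset_pair {α : Type*} [DecidableEq α] {R : Finset α} {e f : α}
    (h : R ⊆ {e, f}) : R = ∅ ∨ R = {e} ∨ R = {f} ∨ R = {e, f} := by
  have h' : (R : Set α) ⊆ {e, f} := by
    rw [← Finset.coe_pair]
    exact Finset.coe_subset.2 h
  rw [Set.subset_pair_iff_eq] at h'
  exact_mod_cast h'

lemma exists_embedding_of_three {V V' : Type} [DecidableEq V] {a b c : V}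
    (hV : ∀ x, x = a ∨ x = b ∨ x = c) (hab : a ≠ b) (hbc : b ≠ c) (hac : a ≠ c) {u v w : V'} (huv : u ≠ v) (hvw : v ≠ w) (huw : u ≠ w) :
    ∃ φ : V ↪ V', φ a = u ∧ φ b = v ∧ φ c = w := by
  have hinj : Function.Injective fun x => if x = a then u else if x = b then v else w := by
    intro x y h
    have hx := hV x
    have hy := hV y
    grind
  exact ⟨⟨_, hinj⟩, if_pos rfl, (if_neg hab.symm).trans (if_pos rfl),
    (if_neg hac.symm).trans (if_neg hbc.symm)⟩

section Cherry

variable {V V' : Type} [DecidableEq V] [DecidableEq V'] {Q : OrientedGraph V}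
  {G : OrientedGraph V'} {a b c : V}

/-- Reversing no edge or both edges of the out-cherry leaves an out-cherry or an in-cherry. The
vertices are abstract because the disjoint union lives on a sigma type. -/
lemma evenReorientation_iff_of_edges_eq (hQ : Q.edges = {(b, a), (b, c)})
    (hV : ∀ x, x = a ∨ x = b ∨ x = c) (hab : a ≠ b) (hbc : b ≠ c) (hac : a ≠ c) :
    Q.EvenReorientation G ↔ ∃ u v w, u ≠ v ∧ v ≠ w ∧ u ≠ w ∧
      (G.edges = {(v, u), (v, w)} ∨ G.edges = {(u, v), (w, v)}) := by
  have he : ((b, a) : V × V) ≠ (b, c) := by simp [hac]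
  constructor
  · rintro ⟨R, hR, hR', φ, hφ⟩
    refine ⟨φ a, φ b, φ c, by simpa, by simpa, by simpa, ?_⟩
    rw [hQ] at hR
    have hcases : R = ∅ ∨ R = {(b, a), (b, c)} := by
      rcases eq_of_subset_pair hR with rfl | rfl | rfl | rfl
      · simp
      · simp at hR'
      · simp at hR'
      · simp
    rcases hcases with rfl | rfl
    · left
      rw [hφ, reorient]
      simp [hQ]
    · right
      rw [hφ, reorient]
      simp [hQ]
  · rintro ⟨u, v, w, huv, hvw, huw, h⟩
    obtain ⟨φ, rfl, rfl, rfl⟩ := exists_embedding_of_three hV hab hbc hac huv hvw huw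
    rcases h with h | h
    · refine ⟨∅, by simp, by simp, φ, ?_⟩
      rw [h, reorient]
      simp [hQ]
    · refine ⟨{(b, a), (b, c)}, hQ.ge, by simp [Finset.card_pair he], φ, ?_⟩
      rw [h, reorient]
      simp [hQ]

lemma oddReorientation_iff_of_edges_eq (hQ : Q.edges = {(b, a), (b, c)})
    (hV : ∀ x, x = a ∨ x = b ∨ x = c) (hab : a ≠ b) (hbc : b ≠ c) (hac : a ≠ c) :
    Q.OddReorientation G ↔ ∃ u v w, u ≠ v ∧ v ≠ w ∧ u ≠ w ∧ G.edges = {(u, v), (v, w)} := by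
  have he : ((b, a) : V × V) ≠ (b, c) := by simp [hac]
  have hedges₁ : (Q.reorient {(b, a)}).edges = {(a, b), (b, c)} := by
    ext ⟨x, y⟩
    simp only [reorient, hQ]
    aesop
  have hedges₂ : (Q.reorient {(b, c)}).edges = {(c, b), (b, a)} := by
    ext ⟨x, y⟩
    simp only [reorient, hQ]
    aesop
  constructor
  · rintro ⟨R, hR, hR', φ, hφ⟩
    rw [hQ] at hR
    have hcases : R = {(b, a)} ∨ R = {(b, c)} := by
      rcases eq_of_subset_pair hR with rfl | rfl | rfl | rfl
      · simp at hR'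
      · simp
      · simp
      · rw [Finset.card_pair he] at hR'
        exact absurd hR' (by decide)
    rcases hcases with rfl | rfl
    · refine ⟨φ a, φ b, φ c, by simpa, by simpa, by simpa, ?_⟩
      rw [hφ, hedges₁]
      simp
    · refine ⟨φ c, φ b, φ a, by simpa using hbc.symm, by simpa using hab.symm,
        by simpa using hac.symm, ?_⟩
      rw [hφ, hedges₂]
      simp
  · rintro ⟨u, v, w, huv, hvw, huw, h⟩
    obtain ⟨φ, rfl, rfl, rfl⟩ := exists_embedding_of_three hV hab hbc hac huv hvw huw
    refine ⟨{(b, a)}, by simp [hQ], by simp, φ, ?_⟩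
    rw [h, hedges₁]
    simp

end Cherry

lemma disjointUnion_pathQ_one_edges :
    (disjointUnion fun i : Fin [1].length => pathQ ([1].get i)).edges =
      {(⟨0, (1 : Fin 3)⟩, ⟨0, (0 : Fin 3)⟩), (⟨0, (1 : Fin 3)⟩, ⟨0, (2 : Fin 3)⟩)} := by
  decide +kernel

lemma spanning_edges_of_subset {V : Type} [DecidableEq V] (C : OrientedGraph V)
    {F : Finset (V × V)} (hF : F ⊆ C.edges) : (C.spanning F).edges = F :=
  Finset.inter_eq_right.2 hF

lemma fst_ne_snd {V : Type} (C : OrientedGraph V) {u v : V} (h : (u, v) ∈ C.edges) : u ≠ v := by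
  rintro rfl
  exact C.asymm _ _ h h

/-- `α_C(2)` counts the pairs of edges with a common source or a common target, minus the directed
paths of length two. -/
lemma alpha_one {V : Type} [hdec : DecidableEq V] (C : OrientedGraph V) :
    C.alpha [1] =
      ((((C.edges ×ˢ C.edges).filter fun p => p.1 ≠ p.2 ∧ (p.1.1 = p.2.1 ∨ p.1.2 = p.2.2)).image
        fun p => ({p.1, p.2} : Finset (V × V))).card : ℤ) -
      ((((C.edges ×ˢ C.edges).filter fun p => p.1.2 = p.2.1).image
        fun p => ({p.1, p.2} : Finset (V × V))).card : ℤ) := by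
  have hV : ∀ x : Σ i : Fin [1].length, Fin (2 * [1].get i + 1),
      x = ⟨0, (0 : Fin 3)⟩ ∨ x = ⟨0, (1 : Fin 3)⟩ ∨ x = ⟨0, (2 : Fin 3)⟩ := by decide
  -- `alpha` is built with classical decidability, so the given instance is identified with it.
  obtain rfl : hdec = fun a b => Classical.propDecidable (a = b) := Subsingleton.elim _ _
  classical
  rw [alpha]
  congr 3
  · ext F
    simp only [Finset.mem_filter, Finset.mem_powerset, Finset.mem_image, Finset.mem_product,
      Prod.exists]
    constructor
    · rintro ⟨hF, h⟩
      have h' := (evenReorientation_iff_of_edges_eq disjointUnion_pathQ_one_edges hV (by decide)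
        (by decide) (by decide)).1 (by convert h)
      rw [spanning_edges_of_subset C hF] at h'
      obtain ⟨u, v, w, huv, hvw, huw, rfl | rfl⟩ := h'
      · exact ⟨v, u, v, w, ⟨⟨hF (by simp), hF (by simp)⟩, by simp [huw], by simp⟩, rfl⟩
      · exact ⟨u, v, w, v, ⟨⟨hF (by simp), hF (by simp)⟩, by simp [huw], by simp⟩, rfl⟩
    · rintro ⟨x, y, z, t, ⟨⟨h1, h2⟩, hne, h⟩, rfl⟩
      have hF : ({(x, y), (z, t)} : Finset (V × V)) ⊆ C.edges := by
        simp [Finset.insert_subset_iff, h1, h2]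
      refine ⟨hF, ?_⟩
      have h' := (evenReorientation_iff_of_edges_eq (G := C.spanning {(x, y), (z, t)})
        disjointUnion_pathQ_one_edges hV (by decide) (by decide) (by decide)).2 ?_
      · convert h'
      rw [spanning_edges_of_subset C hF]
      rcases h with rfl | rfl
      · exact ⟨y, x, t, (C.fst_ne_snd h1).symm, C.fst_ne_snd h2, by simpa using hne, Or.inl rfl⟩
      · exact ⟨x, y, z, C.fst_ne_snd h1, (C.fst_ne_snd h2).symm, by simpa using hne, Or.inr rfl⟩
  · ext F
    simp only [Finset.mem_filter, Finset.mem_powerset, Finset.mem_image, Finset.mem_product,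
      Prod.exists]
    constructor
    · rintro ⟨hF, h⟩
      have h' := (oddReorientation_iff_of_edges_eq disjointUnion_pathQ_one_edges hV (by decide)
        (by decide) (by decide)).1 (by convert h)
      rw [spanning_edges_of_subset C hF] at h'
      obtain ⟨u, v, w, huv, hvw, huw, rfl⟩ := h'
      exact ⟨u, v, v, w, ⟨⟨hF (by simp), hF (by simp)⟩, rfl⟩, rfl⟩
    · rintro ⟨x, y, z, t, ⟨⟨h1, h2⟩, h⟩, rfl⟩
      obtain rfl : y = z := h
      have hF : ({(x, y), (y, t)} : Finset (V × V)) ⊆ C.edges := by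
        simp [Finset.insert_subset_iff, h1, h2]
      refine ⟨hF, ?_⟩
      have h' := (oddReorientation_iff_of_edges_eq (G := C.spanning {(x, y), (y, t)})
        disjointUnion_pathQ_one_edges hV (by decide) (by decide) (by decide)).2 ?_
      · convert h'
      rw [spanning_edges_of_subset C hF]
      refine ⟨x, y, t, C.fst_ne_snd h1, C.fst_ne_snd h2, ?_, rfl⟩
      rintro rfl
      exact C.asymm _ _ h1 h2

lemma gamma_tenCycle : gamma 5 (by norm_num) tenCycle = 1 := by
  rw [gamma, if_pos]
  -- On the same vertices, the two orientations disagree on eight edges.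
  refine ⟨(cycleD 5 (by norm_num)).edges.filter fun e => e ∉ tenCycle.edges,
    Finset.filter_subset _ _, ?_, Function.Embedding.refl _, ?_⟩
  · decide +kernel
  · decide +kernel

lemma alpha_tenCycle : tenCycle.alpha [1] = 2 := by
  rw [alpha_one]
  decide +kernel

lemma cycleSucc_eq_add_one {n : ℕ} (hn : 3 ≤ n + 1) (i : Fin (n + 1)) :
    cycleSucc hn i = i + 1 := by
  ext
  simp [cycleSucc, Fin.val_add]

lemma density_cycle {n : ℕ} (hn : 3 ≤ n + 1) (s : Fin (n + 1) → Bool) (W : I → I → ℝ) :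
    (cycle hn s).density W = ∫ x : Fin (n + 1) → I,
      ∏ i, if s i then W (x i) (x (i + 1)) else W (x (i + 1)) (x i) := by
  have hs : ∀ i : Fin (n + 1), (i.val + 1 < n + 1 ∧ (cycleSucc hn i).val = i.val + 1) ∨
      (i.val + 1 = n + 1 ∧ (cycleSucc hn i).val = 0) := by
    intro i
    rcases Nat.lt_or_ge (i.val + 1) (n + 1) with h | h
    · exact Or.inl ⟨h, Nat.mod_eq_of_lt h⟩
    · have hi : i.val + 1 = n + 1 := by omega
      exact Or.inr ⟨hi, by simp [cycleSucc, hi]⟩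
  rw [density, cycle]
  refine integral_congr_ae (.of_forall fun x => ?_)
  dsimp only
  -- Distinct indices give distinct arcs because the cycle has length at least 3.
  rw [Finset.prod_image]
  · refine Finset.prod_congr rfl fun i _ => ?_
    split_ifs <;> simp [cycleSucc_eq_add_one]
  · intro i _ j _ hij
    have h1 := hs i
    have h2 := hs j
    ext
    dsimp only at hij
    split_ifs at hij <;> simp only [Prod.mk.injEq, Fin.ext_iff] at hij <;> omega

lemma reverse_edges {V : Type} [DecidableEq V] (H : OrientedGraph V) :
    H.reverse.edges = H.edges.image Prod.swap := by
  simp [reverse, reorient]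

lemma density_reverse {V : Type} [DecidableEq V] [Fintype V] (H : OrientedGraph V)
    (W : I → I → ℝ) : H.reverse.density W = H.density fun x y => W y x := by
  rw [density, reverse_edges]
  simp only [Finset.prod_image Prod.swap_injective.injOn]
  rfl

/-- Reversing all edges amounts to transposing the tournamenton. -/
lemma QuasirandomForcing.reverse {V : Type} [DecidableEq V] [Fintype V] {H : OrientedGraph V}
    (h : H.QuasirandomForcing) : H.reverse.QuasirandomForcing := by
  intro W hW hd
  rw [density_reverse, reverse_edges, Finset.card_image_of_injective _ Prod.swap_injective] at hd
  have hae := h (fun x y => W y x) ⟨hW.1.transpose, fun x y => hW.2.1 y x,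
    fun x y => hW.2.2 y x⟩ hd
  filter_upwards [hae] with p hp
  have := hW.2.2 p.1 p.2
  linarith

end OrientedGraph

/-! ### The density bound and quasirandom forcing. -/

open OrientedGraph

/-- The density of `D₁₀` in an antisymmetric kernel as a cyclic integral. -/
lemma density_cycleD_five {U : I → I → ℝ} (hU : IsAntisymmKernel U) :
    (cycleD 5 (by norm_num)).density U =
      -∫ x : Fin 10 → I, ∏ i, U (x i) (x (i + 1)) := by
  change (cycle (n := 9 + 1) _ _).density U = _
  rw [density_cycle, ← integral_neg]
  refine integral_congr_ae (.of_forall fun x => ?_)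
  have h : ∀ i : Fin 10, U (x (i + 1)) (x i) = -U (x i) (x (i + 1)) := fun i => hU.2 _ _
  simp only [h, Fin.prod_univ_succ]
  simp

lemma density_cycleD_five_eq_trace {U : I → I → ℝ} (hU : IsAntisymmKernel U) :
    (cycleD 5 (by norm_num)).density U = -∫ x, kernelPow U (2 * 4 + 1) x x := by
  rw [density_cycleD_five hU, integral_cycle_eq_trace 9 (fun _ => U) (fun _ => hU.1)]
  change -∫ y, kernelCompIter 9 (fun _ => U) (kernelPow U 0) y y = _
  rw [kernelCompIter_kernelPow]

lemma density_tenCycle_ge {U : I → I → ℝ} (hU : IsAntisymmKernel U)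
    (hb : ∀ x y, |U x y| ≤ 1 / 2) :
    (1 / 2 : ℝ) ^ 10 + (cycleD 5 (by norm_num)).density U ≤
      tenCycle.density (fun x y => 1 / 2 + U x y) := by
  have hten : tenCycle.density (fun x y => 1 / 2 + U x y) =
      ∫ x : Fin 10 → I, ∏ j, (1 / 2 +
        (![-1, -1, -1, 1, -1, 1, -1, 1, 1, 1] : Fin 10 → ℝ) j * U (x j) (x (j + 1))) := by
    rw [tenCycle, density_cycle (n := 9)]
    refine integral_congr_ae (.of_forall fun x => Finset.prod_congr rfl fun i _ => ?_)
    rw [hU.2 (x (i + 1)) (x i)]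
    fin_cases i <;> simp
  have hD : ∫ x : Fin 10 → I,
      ∏ j, (![-1, -1, -1, 1, -1, 1, -1, 1, 1, 1] : Fin 10 → ℝ) j * U (x j) (x (j + 1)) =
      (cycleD 5 (by norm_num)).density U := by
    rw [density_cycleD_five hU, ← integral_neg]
    refine integral_congr_ae (.of_forall fun x => ?_)
    simp only [Finset.prod_mul_distrib]
    -- Five arcs run backwards, as in `D₁₀`, so the two sign products agree.
    rw [show ∏ j, (![-1, -1, -1, 1, -1, 1, -1, 1, 1, 1] : Fin 10 → ℝ) j = -1 by
      simp [Fin.prod_univ_succ]]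
    ring
  have hm : ∀ k, ∫ x, iterVec U (2 * k) x = (-1) ^ k * iterNormSq U k := hU.integral_iterVec_even
  rw [hten, integral_cycle_one_half_add hU.1 9, hD,
    sum_tenCycle_eq _ (iterNormSq U 1) (iterNormSq U 2) (iterNormSq U 3) (iterNormSq U 4)
      (by simp [iterVec_zero]) (hU.integral_iterVec_odd (by decide))
      (by simpa using hm 1) (hU.integral_iterVec_odd (by decide))
      (by simpa using hm 2) (hU.integral_iterVec_odd (by decide))
      (by simpa [pow_succ] using hm 3) (hU.integral_iterVec_odd (by decide))
      (by simpa [pow_succ] using hm 4) (hU.integral_iterVec_odd (by decide))]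
  have hpoly := moment_polynomial_nonneg (iterNormSq_nonneg U 1) (hU.iterNormSq_one_le hb)
    (hU.iterNormSq_succ_le hb 1) (hU.iterNormSq_succ_le hb 2) (hU.iterNormSq_convex 1 (1 / 8))
    (hU.iterNormSq_convex 2 (1 / 8))
  linarith

lemma tenCycle_quasirandomForcing : tenCycle.QuasirandomForcing := by
  intro W hW hd
  obtain ⟨hK, h0, h1⟩ := hW
  have hU : IsAntisymmKernel fun x y => W x y - 1 / 2 := by
    refine ⟨IsKernel.iff_bddMeas.2 ?_, fun x y => by linarith [h1 x y]⟩
    simpa only [sub_eq_add_neg] using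
      (IsKernel.iff_bddMeas.1 hK).add (BddMeas.const (-(1 / 2)))
  have hb : ∀ x y, |W x y - 1 / 2| ≤ 1 / 2 := fun x y =>
    abs_le.2 ⟨by linarith [h0 x y], by linarith [h0 y x, h1 x y]⟩
  have hle := density_tenCycle_ge hU hb
  simp only [add_sub_cancel] at hle
  rw [hd, show tenCycle.edges.card = 10 by decide +kernel, density_cycleD_five_eq_trace hU] at hle
  have htr := hU.trace_kernelPow 4
  have hnn : 0 ≤ ∫ p : I × I, kernelPow (fun x y => W x y - 1 / 2) 4 p.1 p.2 ^ 2 :=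
    integral_nonneg fun _ => sq_nonneg _
  -- The bound gives `tr U¹⁰ ≥ 0`, while `tr U¹⁰ = -‖U⁵‖² ≤ 0`.
  have hae := hU.ae_eq_zero_of_trace_kernelPow 4 (by
    norm_num at htr hle ⊢
    linarith)
  filter_upwards [hae] with p hp
  linarith

theorem mainTheorem12 :
    OrientedGraph.gamma 5 (by norm_num) tenCycle = 1 ∧
    tenCycle.alpha [1] = 2 ∧
    (∀ U : unitInterval → unitInterval → ℝ, IsAntisymmKernel U → (∀ x y, |U x y| ≤ 1 / 2) →
      (1 / 2 : ℝ) ^ 10 + (OrientedGraph.cycleD 5 (by norm_num)).density U ≤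
        tenCycle.density (fun x y => 1 / 2 + U x y)) ∧
    tenCycle.QuasirandomForcing ∧
    tenCycle.reverse.QuasirandomForcing :=
  ⟨gamma_tenCycle, alpha_tenCycle, fun _ hU hb => density_tenCycle_ge hU hb,
    tenCycle_quasirandomForcing, tenCycle_quasirandomForcing.reverse⟩
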